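/- Fix $\theta^*\in[0,1]$. A labeler answers a query at $x\in[0,1]$ with a random $Y\in\{0,1,\perp\}$, distributed as $P(\cdot\mid x)$ independently of the past. Consider two conditions. Condition 1. For all $x,x'\in[0,1]$ with $|x-\theta^*|\ge|x'-\theta^*|$ we have $P(\perp\mid x)\le P(\perp\mid x')$; and $P(Y\ne\mathbb 1[x>\theta^*]\mid x,Y\ne\perp)\le\frac12$ for all $x\in[0,1]$ with $P(\perp\mid x)<1$. Condition 2 (with constants $C>0$, $\beta\ge0$ and a nondecreasing $f:[0,1]\to[0,1]$). For all $x\in[0,1]$, $P(\perp\mid x)\le 1-f(|x-\theta^*|)$; and $P(Y\ne\mathbb 1[x>\theta^*]\mid x,Y\ne\perp)\le\frac12\left(1-C|x-\theta^*|^{\beta}\right)$ if $P(\perp\mid x)<1$. Let $[\ln\ln]_+(x)=\ln\ln\max\{x,e^e\}$ and fix positive constants $D_0,D_1$. For a finite real sequence $X=(X_1,\dots,X_n)$ and a level $\eta$ define two tests. $\mathrm{CS}(X,\eta)$ holds iff $$\sum_{i=1}^n X_i\ge D_0\Big(1+\ln\tfrac1\eta+\sqrt{4n\left([\ln\ln]_+(4n)+\ln\tfrac1\eta\right)}\Big).$$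 $\mathrm{CSV}(X,\eta)$ holds iff $n\ge\ln\frac1\eta$ and $$\sum_{i=1}^n X_i\ge D_1\Big(1+\ln\tfrac1\eta+\sqrt{W\left([\ln\ln]_+(W)+\ln\tfrac1\eta\right)}\Big),$$ where $W=\mathrm{Var}+\ln\frac1\eta+1$ and $\mathrm{Var}=\frac{n}{n-1}\big(\sum_i X_i^2-\frac1n(\sum_i X_i)^2\big)$ (with $\mathrm{Var}=0$ for $n=1$). The algorithm has as input only $\delta\in(0,1)$ and $\epsilon\in(0,\frac12]$ such that $m=\log_{4/3}\frac1{2\epsilon}$ is an integer. Put $\eta=\delta/(4m)$. It starts with $[L,R]=[0,1]$ and performs $m$ phases. A phase begins with empty arrays $A^{(u)},A^{(m)},A^{(v)},B^{(u)},B^{(v)}$ and repeats the following round until the interval changes. Query once at each of $U=\frac{3L+R}4$, $M=\frac{L+R}2$, $V=\frac{L+3R}4$. For each $w\in\{u,m,v\}$ append to $A^{(w)}$ a $1$ if the response at the corresponding point is a label and a $0$ if it is $\perp$; for $w\in\{u,v\}$ append $1$ to $B^{(w)}$ for label $1$, $-1$ for label $0$, and nothing for $\perp$. Then perform the first of these actions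 whose test holds, if any, and end the phase: 1. if $\mathrm{CSV}(A^{(u)}-A^{(m)},\eta)$, set $[L,R]\leftarrow[U,R]$; 2. if $\mathrm{CSV}(A^{(v)}-A^{(m)},\eta)$, set $[L,R]\leftarrow[L,V]$; 3. if $\mathrm{CS}(-B^{(u)},\eta)$, set $[L,R]\leftarrow[U,R]$; 4. if $\mathrm{CS}(B^{(v)},\eta)$, set $[L,R]\leftarrow[L,V]$. After the $m$ phases it outputs $(L+R)/2$. Theorem. For all $D_0,D_1,C>0$ and $\beta\ge0$ there is a constant $K>0$, depending only on these four numbers, such that for every nondecreasing $f:[0,1]\to[0,1]$, every $\theta^*\in[0,1]$, every labeler satisfying Conditions 1 and 2, and all inputs $\epsilon,\delta$ as above with $f(\epsilon/2)>0$, with probability at least $1-\delta$ the total number of queries made by the algorithm is at most $$K\,\frac{\epsilon^{-2\beta}}{f(\epsilon/2)}\,\ln\frac1\epsilon\left(\ln\frac1\delta+[\ln\ln]_+\frac1\epsilon\right)[\ln\ln]_+\frac1\epsilon,$$ that is, $\tilde O\big(\epsilon^{-2\beta}/f(\epsilon/2)\big)$, where $\tilde O$ hides logarithmic factors in $1/\epsilon$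 and $1/\delta$. In particular the algorithm stops with this probability. The algorithm does not need to know $f$, $C$ or $\beta$. -/

import Mathlib

noncomputable section

namespace AbstainingLabeler

/-! ### Labelers on the instance space `[0,1]`

A response is `some true` (label 1), `some false` (label 0) or `none` (the labeler abstains).
A labeler is the family of its response distributions `P(Y | X = x)`. Points are real numbers;
only those in `[0,1]` matter. -/

/-- The ground truth label `𝟙[x > θ]`. -/
def trueLabel (θ x : ℝ) : Bool := decide (θ < x)

/-- `P(⊥ | x)`. -/
def abstention (P : ℝ → PMF (Option Bool)) (x : ℝ) : ℝ := (P x none).toReal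

/-- `P(Y ≠ ⊥ | x)`. -/
def answerProb (P : ℝ → PMF (Option Bool)) (x : ℝ) : ℝ :=
  (P x (some false)).toReal + (P x (some true)).toReal

/-- `P(Y ≠ 𝟙[x > θ] | x, Y ≠ ⊥)`, meaningful when `P(Y ≠ ⊥ | x) > 0`. -/
def noiseRate (P : ℝ → PMF (Option Bool)) (θ x : ℝ) : ℝ :=
  (P x (some (!trueLabel θ x))).toReal / answerProb P x

/-- The abstention rate does not increase with the distance to the decision boundary, and given
that the labeler answers, it is wrong with probability at most `1/2`. -/
structure MonotoneAbstention (P : ℝ → PMF (Option Bool)) (θ : ℝ) : Prop where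
  abstention_le : ∀ x ∈ Set.Icc (0 : ℝ) 1, ∀ x' ∈ Set.Icc (0 : ℝ) 1,
    |x' - θ| ≤ |x - θ| → abstention P x ≤ abstention P x'
  noise_le : ∀ x ∈ Set.Icc (0 : ℝ) 1, 0 < answerProb P x → noiseRate P θ x ≤ 1 / 2

/-- Abstention at most `1 - f(|x - θ|)`, and Tsybakov-type noise with parameters `C` and `β`. -/
structure BoundedNoise (P : ℝ → PMF (Option Bool)) (θ : ℝ) (f : ℝ → ℝ) (C β : ℝ) : Prop where
  abstention_le : ∀ x ∈ Set.Icc (0 : ℝ) 1, abstention P x ≤ 1 - f |x - θ|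
  noise_le : ∀ x ∈ Set.Icc (0 : ℝ) 1, 0 < answerProb P x →
    noiseRate P θ x ≤ 1 / 2 * (1 - C * |x - θ| ^ β)

/-! ### The sequential tests -/

/-- `[ln ln]₊ x = ln ln max {x, e^e}`. -/
def logLogPlus (x : ℝ) : ℝ := Real.log (Real.log (max x (Real.exp (Real.exp 1))))

/-- The test `CheckSignificant`, with constant `D₀`. -/
def CheckSignificant (D₀ : ℝ) (X : List ℝ) (δ : ℝ) : Prop :=
  D₀ * (1 + Real.log (1 / δ) +
      √(4 * X.length * (logLogPlus (4 * X.length) + Real.log (1 / δ)))) ≤ X.sum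

/-- The empirical variance used by `CheckSignificantVar`. -/
def empVar (X : List ℝ) : ℝ :=
  (X.length : ℝ) / ((X.length : ℝ) - 1) *
    ((X.map fun x => x ^ 2).sum - 1 / (X.length : ℝ) * X.sum ^ 2)

/-- The test `CheckSignificant-Var`, with constant `D₁`. -/
def CheckSignificantVar (D₁ : ℝ) (X : List ℝ) (δ : ℝ) : Prop :=
  Real.log (1 / δ) ≤ X.length ∧
    D₁ * (1 + Real.log (1 / δ) +
      √((empVar X + Real.log (1 / δ) + 1) *
        (logLogPlus (empVar X + Real.log (1 / δ) + 1) + Real.log (1 / δ)))) ≤ X.sum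

/-! ### The algorithm

It is run round by round: a round queries the three quartiles of the current interval once each,
records the responses, performs the four tests, and possibly moves on to the next phase with
a shorter interval. -/

/-- The responses at the three quartiles in one round. -/
structure Reply where
  u : Option Bool
  m : Option Bool
  v : Option Bool

/-- The memory of the algorithm: the number of the current phase, the current interval `[L, R]`,
the arrays of the phase, and the number of queries made since the start. -/
structure State where
  phase : ℕ
  L : ℝ
  R : ℝ
  Au : List ℝ
  Am : List ℝ
  Av : List ℝ
  Bu : List ℝ
  Bv : List ℝ
  queries : ℕ

namespace State

/-- The quartile `U`. -/
def U (s : State) : ℝ := (3 * s.L + s.R) / 4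

/-- The midpoint `M`. -/
def M (s : State) : ℝ := (s.L + s.R) / 2

/-- The quartile `V`. -/
def V (s : State) : ℝ := (s.L + 3 * s.R) / 4

/-- The state at the start of a phase: the arrays are empty. -/
def start (k : ℕ) (L R : ℝ) (q : ℕ) : State := ⟨k, L, R, [], [], [], [], [], q⟩

/-- The output `(L + R) / 2`, read off when the algorithm has stopped. -/
def estimate (s : State) : ℝ := (s.L + s.R) / 2

end State

/-- Append `1` for an answer and `0` for an abstention. -/
def appendA (A : List ℝ) : Option Bool → List ℝ
  | none => A ++ [0]
  | some _ => A ++ [1]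

/-- Append `1` for label 1, `-1` for label 0, nothing for an abstention. -/
def appendB (B : List ℝ) : Option Bool → List ℝ
  | none => B
  | some true => B ++ [1]
  | some false => B ++ [-1]

/-- Record the three responses of a round. -/
def record (s : State) (r : Reply) : State :=
  { s with
    Au := appendA s.Au r.u
    Am := appendA s.Am r.m
    Av := appendA s.Av r.v
    Bu := appendB s.Bu r.u
    Bv := appendB s.Bv r.v
    queries := s.queries + 3 }

/-- The number `log_{4/3} (1 / (2ε))` of phases (exact when that number is a natural number). -/
def numPhases (ε : ℝ) : ℕ := ⌊Real.logb (4 / 3) (1 / (2 * ε))⌋₊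

/-- The confidence level `δ / (4 log_{4/3} (1 / (2ε)))` of each test. -/
def testLevel (ε δ : ℝ) : ℝ := δ / (4 * Real.logb (4 / 3) (1 / (2 * ε)))

/-- The algorithm is still making queries. -/
def Running (ε : ℝ) (s : State) : Prop := s.phase < numPhases ε

open Classical in
/-- The four tests at the end of a round. -/
def test (D₀ D₁ ε δ : ℝ) (s : State) : State :=
  if CheckSignificantVar D₁ (List.zipWith (· - ·) s.Au s.Am) (testLevel ε δ) then
    State.start (s.phase + 1) s.U s.R s.queries
  else if CheckSignificantVar D₁ (List.zipWith (· - ·) s.Av s.Am) (testLevel ε δ) then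
    State.start (s.phase + 1) s.L s.V s.queries
  else if CheckSignificant D₀ (s.Bu.map fun b => -b) (testLevel ε δ) then
    State.start (s.phase + 1) s.U s.R s.queries
  else if CheckSignificant D₀ s.Bv (testLevel ε δ) then
    State.start (s.phase + 1) s.L s.V s.queries
  else s

open Classical in
/-- One round of the algorithm, given the responses; nothing happens once it has stopped. -/
def step (D₀ D₁ ε δ : ℝ) (s : State) (r : Reply) : State :=
  if Running ε s then test D₀ D₁ ε δ (record s r) else s

/-- The state after `t` rounds when the responses in round `i` (counted from `0`, across all
phases) are `y i`. -/
def stateAt (D₀ D₁ ε δ : ℝ) (y : ℕ → Reply) : ℕ → State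
  | 0 => State.start 0 0 1 0
  | t + 1 => step D₀ D₁ ε δ (stateAt D₀ D₁ ε δ y t) (y t)

/-- The total number of queries made on the response sequence `y`; it is `⊤` if the algorithm
does not stop. -/
def numQueries (D₀ D₁ ε δ : ℝ) (y : ℕ → Reply) : ℕ∞ :=
  ⨆ t : ℕ, ((stateAt D₀ D₁ ε δ y t).queries : ℕ∞)

/-- The random responses `Y` are those of the labeler `P` to the algorithm: given the responses in
all earlier rounds, and as long as the algorithm is running, the three responses of the current
round are independent and distributed as `P(· | U)`, `P(· | M)`, `P(· | V)` at the
points that the algorithm queries in that round. -/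
structure IsInteraction (D₀ D₁ ε δ : ℝ) (P : ℝ → PMF (Option Bool))
    {Ω : Type*} [MeasurableSpace Ω] (μ : MeasureTheory.Measure Ω) (Y : ℕ → Ω → Reply) : Prop where
  measurable : ∀ (t : ℕ) (r : Reply), MeasurableSet {ω | Y t ω = r}
  law : ∀ (t : ℕ) (h : ℕ → Reply) (r : Reply), Running ε (stateAt D₀ D₁ ε δ h t) →
    μ {ω | (∀ i < t, Y i ω = h i) ∧ Y t ω = r} =
      μ {ω | ∀ i < t, Y i ω = h i} *
        (P (stateAt D₀ D₁ ε δ h t).U r.u * P (stateAt D₀ D₁ ε δ h t).M r.m *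
          P (stateAt D₀ D₁ ε δ h t).V r.v)

end AbstainingLabeler

end

namespace AbstainingLabeler

open Real

/-! ### Elementary inequalities -/

/-! The running time is controlled by one exponential supermartingale that spans all phases. In each
round one of the outer quartiles lies on the far side of the midpoint from `θ`, hence at distance
more than `ε / 2` from `θ`, whether or not `θ` is still in the interval. There the labeler answers
with probability at least `b = f (ε / 2)`, and its answers have bias at least `c = C * (ε / 2) ^ β`.
Let `S` be the signed label sum and `n` the number of labels there in the current phase. The weight
`exp (-(c/2) S + (c²/8) n)` then shrinks in expectation by `exp (-b c²/16)` per round (`mgf_le`,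
`sum_potential_step_le`).

As long as the label tests fail, `S` is below its threshold. This is of order `√(n log log n)`, so
the exponent stays above some `-G` uniformly in `n` (`threshold_le`). Charging `G + 1` per phase
makes `potential` nonincreasing when a phase ends, whichever test ended it and whichever interval
was kept (`potential_step_le`). Correctness of the moves is therefore irrelevant.

A running algorithm has potential at least `exp (-(G + 1) k)`, with `k` the number of phases. A
Markov-type bound gives probability at most `exp ((G + 1) k - t b c²/16)` of running after `t`
rounds (`measure_running_le`). It remains to solve for `t`, using `k = O(log (1/ε))` and `G = O(log
(1/δ) + log log (1/ε))`. -/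

lemma exp_mul_one_add_half_le {c : ℝ} (h0 : 0 ≤ c) (h1 : c ≤ 1) :
    (1 + c) / 2 * exp (-(c / 2)) + (1 - c) / 2 * exp (c / 2) ≤ exp (-(c ^ 2 / 4)) := by
  have hcosh : cosh (c / 2) ≤ 1 + (c / 2) ^ 2 := by
    refine (cosh_le_exp_half_sq _).trans ?_
    have hx : |(c / 2) ^ 2 / 2| ≤ 1 := by
      rw [abs_of_nonneg (by positivity)]
      nlinarith
    have := (abs_le.1 (abs_exp_sub_one_le hx)).2
    rw [abs_of_nonneg (by positivity)] at this
    linarith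
  have hsinh : c / 2 ≤ sinh (c / 2) := self_le_sinh_iff.2 (by linarith)
  have hexp := add_one_le_exp (-(c ^ 2 / 4))
  -- In this form the bounds on `cosh` and `sinh` give at most `1 + c²/4 - c²/2 = 1 - c²/4`.
  have hid : (1 + c) / 2 * exp (-(c / 2)) + (1 - c) / 2 * exp (c / 2)
      = cosh (c / 2) - c * sinh (c / 2) := by
    rw [cosh_eq, sinh_eq]
    ring
  rw [hid]
  nlinarith [mul_le_mul_of_nonneg_left hsinh h0]

/-- One step of the exponential supermartingale: with probability `a` the labeler answers, and then
it is wrong with probability at most `(1 - c) / 2`. -/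
lemma mgf_le {c p w q b : ℝ} (h0 : 0 ≤ c) (h1 : c ≤ 1) (hsum : p + w + q = 1)
    (hw : 0 ≤ w) (hq : 0 ≤ q) (hqw : q ≤ (1 - c) / 2 * (w + q)) (hb : b ≤ w + q) :
    p + w * exp (-(c / 2) + c ^ 2 / 8) + q * exp (c / 2 + c ^ 2 / 8) ≤ exp (-(b * c ^ 2 / 16)) := by
  have hmono : exp (-(c / 2)) ≤ exp (c / 2) := exp_le_exp.2 (by linarith)
  have h2 : w * exp (-(c / 2)) + q * exp (c / 2) ≤ (w + q) * exp (-(c ^ 2 / 4)) := by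
    have := mul_le_mul_of_nonneg_left (exp_mul_one_add_half_le h0 h1) (add_nonneg hw hq)
    -- Moving mass from right to wrong answers only increases the left side, so the extreme split
    -- `(1 ± c) / 2` is the worst.
    nlinarith [mul_nonneg (sub_nonneg.2 hqw) (sub_nonneg.2 hmono)]
  -- Half of the gain `c²/4` per answer is given up for the drift `c²/8` on the label count.
  have h3 : w * exp (-(c / 2) + c ^ 2 / 8) + q * exp (c / 2 + c ^ 2 / 8)
      ≤ (w + q) * exp (-(c ^ 2 / 8)) := by
    have := mul_le_mul_of_nonneg_right h2 (exp_pos (c ^ 2 / 8)).le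
    rw [mul_assoc, ← exp_add, add_mul, mul_assoc, mul_assoc, ← exp_add, ← exp_add] at this
    calc _ ≤ _ := this
      _ = _ := by ring_nf
  -- Linearising turns the gain per answer into a gain per round, proportional to the answer
  -- probability.
  have h4 : exp (-(c ^ 2 / 8)) ≤ 1 - c ^ 2 / 16 := by
    have hx : |-(c ^ 2 / 8)| ≤ 1 := by
      rw [abs_neg, abs_of_nonneg (by positivity)]
      nlinarith
    have := (abs_le.1 (abs_exp_sub_one_sub_id_le hx)).2
    have hc : c ^ 2 ≤ 1 := by nlinarith
    nlinarith [sq_nonneg c]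
  have h5 := mul_le_mul_of_nonneg_left h4 (add_nonneg hw hq)
  have h6 := add_one_le_exp (-(b * c ^ 2 / 16))
  nlinarith [mul_le_mul_of_nonneg_right hb (sq_nonneg c)]

/-! ### The threshold of `CheckSignificant` -/

lemma one_le_logLogPlus (x : ℝ) : 1 ≤ logLogPlus x := by
  have h : exp 1 ≤ log (max x (exp (exp 1))) := by
    rw [le_log_iff_exp_le (lt_max_of_lt_right (exp_pos _))]
    exact le_max_right _ _
  exact (le_log_iff_exp_le ((exp_pos 1).trans_le h)).2 h

/-- The value that the sum of `n` entries has to reach in `CheckSignificant`, where `l` is the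
logarithm of the inverse level. -/
noncomputable def threshold (D l : ℝ) (n : ℕ) : ℝ :=
  D * (1 + l + √(4 * n * (logLogPlus (4 * n) + l)))

lemma checkSignificant_iff {D δ : ℝ} {X : List ℝ} :
    CheckSignificant D X δ ↔ threshold D (log (1 / δ)) X.length ≤ X.sum := Iff.rfl

lemma threshold_nonneg {D l : ℝ} (hD : 0 < D) (hl : 0 ≤ l) (n : ℕ) : 0 ≤ threshold D l n := by
  unfold threshold
  positivity

lemma log_le_mul_sub_log {x a : ℝ} (hx : 0 < x) (ha : 0 < a) : log x ≤ a * x - log a := by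
  have := log_le_sub_one_of_pos (mul_pos ha hx)
  rw [log_mul ha.ne' hx.ne'] at this
  linarith

/-- The iterated logarithm is dominated by a linear function of slope `a`, up to a constant of
order `log (log (1 / a))`. -/
lemma logLogPlus_le {x a B : ℝ} (hx : 0 ≤ x) (ha : 0 < a) (hB : 1 ≤ B) (haB : -log a ≤ B) :
    logLogPlus x ≤ log B + a * (x + exp (exp 1)) := by
  set z := max x (exp (exp 1)) with hz
  have hz0 : 0 < z := lt_max_of_lt_right (exp_pos _)
  have hzx : z ≤ x + exp (exp 1) := max_le (by linarith [exp_pos (exp 1)]) (by linarith)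
  have h1 := log_le_mul_sub_log hz0 ha
  have hlz : 0 < log z := by
    have h : exp 1 ≤ log z := (le_log_iff_exp_le hz0).2 (le_max_right _ _)
    exact (exp_pos 1).trans_le h
  have hB0 : 0 < B := by linarith
  -- Tangent of `log` at `B`: `log (log z) ≤ log B + log z / B - 1`. The `-1` absorbs the constant
  -- in `h3`.
  have h2 := log_le_sub_one_of_pos (div_pos hlz hB0)
  rw [log_div hlz.ne' hB0.ne'] at h2
  have h3 : log z / B ≤ a * z + 1 := by
    rw [div_le_iff₀ hB0]
    nlinarith [mul_pos ha hz0]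
  have h4 := mul_le_mul_of_nonneg_left hzx ha.le
  change log (log z) ≤ _
  linarith

/-- The drift `c²/8` per label dominates the square root in the threshold, so the bound is uniform
in `n`. One half of the drift pays for AM-GM on the square root, the other half for the linear
majorant of the iterated logarithm. -/
lemma threshold_le {D l c B : ℝ} (hD : 0 < D) (hl : 0 ≤ l) (h0 : 0 < c) (h1 : c ≤ 1) (hB : 1 ≤ B)
    (hcB : -log (c ^ 2 / (256 * D ^ 2)) ≤ B) (n : ℕ) :
    c / 2 * threshold D l n - c ^ 2 / 8 * n
      ≤ D * (1 + l) + 4 * D ^ 2 * (log B + l) + exp (exp 1) := by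
  have hn : (0 : ℝ) ≤ n := n.cast_nonneg
  have hΛ := one_le_logLogPlus (4 * n)
  have hL := logLogPlus_le (x := 4 * n) (by positivity) (by positivity) hB hcB
  set Q := logLogPlus (4 * n) + l with hQ
  have hQ0 : 0 ≤ Q := by linarith
  have hsq : c / 2 * (D * √(4 * n * Q)) ≤ c ^ 2 * n / 16 + 4 * D ^ 2 * Q := by
    have hs : √(4 * n * Q) = 2 * (√n * √Q) := by
      rw [mul_assoc, sqrt_mul (by norm_num), sqrt_mul hn]
      congr 1
      rw [show (4 : ℝ) = 2 ^ 2 by norm_num, sqrt_sq (by norm_num)]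
    rw [hs]
    nlinarith [sq_nonneg (c * √n / 4 - 2 * D * √Q), sq_sqrt hn, sq_sqrt hQ0]
  have hD2 : (0 : ℝ) < D ^ 2 := by positivity
  -- The slope `c² / (256 D²)` is chosen so that this term costs exactly the remaining `c² n / 16`.
  have hlin : 4 * D ^ 2 * (c ^ 2 / (256 * D ^ 2) * (4 * n + exp (exp 1)))
      = c ^ 2 * n / 16 + c ^ 2 * exp (exp 1) / 64 := by
    field_simp
    ring
  have hc2 : c ^ 2 ≤ 1 := by nlinarith
  have he : c ^ 2 * exp (exp 1) / 64 ≤ exp (exp 1) := by nlinarith [exp_pos (exp 1)]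
  have h5 := mul_le_mul_of_nonneg_left hL (by positivity : 0 ≤ 4 * D ^ 2)
  have h6 : c / 2 * (D * (1 + l)) ≤ D * (1 + l) := by
    have : 0 ≤ D * (1 + l) := by positivity
    nlinarith
  have hex : threshold D l n = D * (1 + l) + D * √(4 * n * Q) := by
    rw [threshold]
    ring
  rw [hex]
  nlinarith

/-! ### The potential -/

/-- The evidence gathered in the current phase at the quartile that is far from the boundary:
the sum of the labels there, signed so that the true label counts positively. -/
noncomputable def evidence (θ : ℝ) (s : State) : ℝ := if θ ≤ s.M then s.Bv.sum else -s.Bu.sum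

/-- The number of labels received in the current phase at the quartile far from the boundary. -/
noncomputable def answers (θ : ℝ) (s : State) : ℕ := if θ ≤ s.M then s.Bv.length else s.Bu.length

/-- The exponential potential, which shrinks in expectation by a constant factor per round. -/
noncomputable def potential (θ c G : ℝ) (s : State) : ℝ :=
  exp (-(c / 2) * evidence θ s + c ^ 2 / 8 * answers θ s - (G + 1) * s.phase)

/-- What holds of all reachable states: the interval lies in `[0, 1]`, it has the right length, and
no test on labels holds. -/
structure Reachable (D l : ℝ) (s : State) : Prop where
  zero_le : 0 ≤ s.L
  le_one : s.R ≤ 1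
  length_eq : s.R - s.L = (3 / 4) ^ s.phase
  sum_Bv_le : s.Bv.sum ≤ threshold D l s.Bv.length
  neg_sum_Bu_le : -s.Bu.sum ≤ threshold D l s.Bu.length

/-! ### Invariants of the reachable states -/

lemma sum_map_neg_list (X : List ℝ) : (X.map fun b => -b).sum = -X.sum := by
  induction X with
  | nil => simp
  | cons a X ih => simp only [List.map_cons, List.sum_cons, ih]; ring

lemma reachable_start_right {D l : ℝ} (hD : 0 < D) (hl : 0 ≤ l) {s : State}
    (hs : Reachable D l s) (q : ℕ) : Reachable D l (State.start (s.phase + 1) s.U s.R q) := by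
  have h := hs.length_eq
  have hp : (0 : ℝ) < (3 / 4) ^ s.phase := by positivity
  refine ⟨?_, hs.le_one, ?_, ?_, ?_⟩
  · have := hs.zero_le
    simp only [State.start, State.U]
    linarith
  · simp only [State.start, State.U, pow_succ]
    linarith
  · simpa [State.start] using threshold_nonneg hD hl 0
  · simpa [State.start] using threshold_nonneg hD hl 0

lemma reachable_start_left {D l : ℝ} (hD : 0 < D) (hl : 0 ≤ l) {s : State}
    (hs : Reachable D l s) (q : ℕ) : Reachable D l (State.start (s.phase + 1) s.L s.V q) := by
  have h := hs.length_eq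
  have hp : (0 : ℝ) < (3 / 4) ^ s.phase := by positivity
  refine ⟨hs.zero_le, ?_, ?_, ?_, ?_⟩
  · have := hs.le_one
    simp only [State.start, State.V]
    linarith
  · simp only [State.start, State.V, pow_succ]
    linarith
  · simpa [State.start] using threshold_nonneg hD hl 0
  · simpa [State.start] using threshold_nonneg hD hl 0

/-- A round either starts a new phase, on one of two intervals, or ends with both tests on
labels failing. -/
lemma test_cases (D₀ D₁ ε δ : ℝ) (s : State) :
    test D₀ D₁ ε δ s = State.start (s.phase + 1) s.U s.R s.queries ∨
    test D₀ D₁ ε δ s = State.start (s.phase + 1) s.L s.V s.queries ∨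
    (test D₀ D₁ ε δ s = s ∧ ¬ CheckSignificant D₀ (s.Bu.map fun b => -b) (testLevel ε δ) ∧
      ¬ CheckSignificant D₀ s.Bv (testLevel ε δ)) := by
  unfold test
  split_ifs <;> simp_all

lemma reachable_step {D₀ D₁ ε δ : ℝ} (hD : 0 < D₀) (hl : 0 ≤ log (1 / testLevel ε δ)) {s : State}
    (hs : Reachable D₀ (log (1 / testLevel ε δ)) s) (r : Reply) :
    Reachable D₀ (log (1 / testLevel ε δ)) (step D₀ D₁ ε δ s r) := by
  unfold step
  split_ifs
  · rcases test_cases D₀ D₁ ε δ (record s r) with h | h | ⟨h, hu, hv⟩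
    · rw [h]
      exact reachable_start_right hD hl hs _
    · rw [h]
      exact reachable_start_left hD hl hs _
    · rw [h]
      rw [checkSignificant_iff, not_le] at hu hv
      rw [sum_map_neg_list, List.length_map] at hu
      exact ⟨hs.zero_le, hs.le_one, hs.length_eq, hv.le, hu.le⟩
  · exact hs

lemma reachable_stateAt {D₀ D₁ ε δ : ℝ} (hD : 0 < D₀) (hl : 0 ≤ log (1 / testLevel ε δ))
    (y : ℕ → Reply) (t : ℕ) :
    Reachable D₀ (log (1 / testLevel ε δ)) (stateAt D₀ D₁ ε δ y t) := by
  induction t with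
  | zero =>
    refine ⟨?_, ?_, ?_, ?_, ?_⟩
    · simp [stateAt, State.start]
    · simp [stateAt, State.start]
    · simp [stateAt, State.start]
    · simpa [stateAt, State.start] using threshold_nonneg hD hl 0
    · simpa [stateAt, State.start] using threshold_nonneg hD hl 0
  | succ t ih => exact reachable_step hD hl ih _

lemma Reachable.evidence_le {D l θ : ℝ} {s : State} (hs : Reachable D l s) :
    evidence θ s ≤ threshold D l (answers θ s) := by
  unfold evidence answers
  split_ifs
  · exact hs.sum_Bv_le
  · exact hs.neg_sum_Bu_le

/-- The factor by which a response changes the potential; `b` is the true label. -/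
noncomputable def factor (c : ℝ) (b : Bool) : Option Bool → ℝ
  | none => 1
  | some y => if y = b then exp (-(c / 2) + c ^ 2 / 8) else exp (c / 2 + c ^ 2 / 8)

lemma potential_record (θ c G : ℝ) (s : State) (r : Reply) :
    potential θ c G (record s r) = potential θ c G s *
      if θ ≤ s.M then factor c true r.v else factor c false r.u := by
  have hM : (record s r).M = s.M := rfl
  have hp : (record s r).phase = s.phase := rfl
  unfold potential evidence answers
  rw [hM, hp]
  split_ifs with h
  · rcases hr : r.v with _ | _ | _ <;> simp [record, hr, appendB, factor, ← exp_add] <;> ring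
  · rcases hr : r.u with _ | _ | _ <;> simp [record, hr, appendB, factor, ← exp_add] <;> ring

lemma evidence_record_le (θ : ℝ) (s : State) (r : Reply) :
    evidence θ (record s r) ≤ evidence θ s + 1 := by
  have hM : (record s r).M = s.M := rfl
  unfold evidence
  rw [hM]
  split_ifs with h
  · rcases hr : r.v with _ | _ | _ <;> simp [record, hr, appendB]
  · rcases hr : r.u with _ | _ | _ <;> simp [record, hr, appendB]

lemma answers_le_record (θ : ℝ) (s : State) (r : Reply) :
    answers θ s ≤ answers θ (record s r) := by
  have hM : (record s r).M = s.M := rfl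
  unfold answers
  rw [hM]
  split_ifs with h
  · rcases hr : r.v with _ | _ | _ <;> simp [record, hr, appendB]
  · rcases hr : r.u with _ | _ | _ <;> simp [record, hr, appendB]

lemma potential_start (θ c G : ℝ) (k : ℕ) (L R : ℝ) (q : ℕ) :
    potential θ c G (State.start k L R q) = exp (-((G + 1) * k)) := by
  have he : evidence θ (State.start k L R q) = 0 := by
    unfold evidence
    split_ifs <;> simp [State.start]
  have ha : answers θ (State.start k L R q) = 0 := by
    unfold answers
    split_ifs <;> rfl
  rw [potential, he, ha]
  simp [State.start]

/-- A reset at the end of a phase cannot raise the potential. Before the round the label exponent is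
at least `-G`, and one more label lowers it by at most `c / 2 ≤ 1`, which the charge `G + 1` for a
new phase covers. -/
lemma potential_step_le {D₀ D₁ ε δ θ c G l : ℝ} (h0 : 0 ≤ c) (h1 : c ≤ 1)
    (hG : ∀ n : ℕ, c / 2 * threshold D₀ l n - c ^ 2 / 8 * n ≤ G)
    {s : State} (hs : Reachable D₀ l s) (hrun : Running ε s) (r : Reply) :
    potential θ c G (step D₀ D₁ ε δ s r) ≤ potential θ c G s *
      if θ ≤ s.M then factor c true r.v else factor c false r.u := by
  rw [← potential_record]
  have hnew : exp (-((G + 1) * ((record s r).phase + 1 : ℕ))) ≤ potential θ c G (record s r) := by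
    rw [potential, exp_le_exp]
    have he := evidence_record_le θ s r
    have ha : (answers θ s : ℝ) ≤ answers θ (record s r) := by
      exact_mod_cast answers_le_record θ s r
    have hg := hG (answers θ s)
    have ht := hs.evidence_le (θ := θ)
    push_cast
    nlinarith [mul_le_mul_of_nonneg_left (he.trans (add_le_add_left ht 1)) h0,
      mul_le_mul_of_nonneg_left ha (sq_nonneg c)]
  rw [step, if_pos hrun]
  rcases test_cases D₀ D₁ ε δ (record s r) with h | h | ⟨h, -, -⟩
  · rwa [h, potential_start]
  · rwa [h, potential_start]
  · rw [h]

lemma one_le_potential {ε θ c G l D₀ : ℝ} (h0 : 0 ≤ c)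
    (hG : ∀ n : ℕ, c / 2 * threshold D₀ l n - c ^ 2 / 8 * n ≤ G) (hG0 : 0 ≤ G)
    {s : State} (hs : Reachable D₀ l s) (hrun : Running ε s) :
    1 ≤ exp ((G + 1) * numPhases ε) * potential θ c G s := by
  rw [potential, ← exp_add, one_le_exp_iff]
  have hg := hG (answers θ s)
  have ht := mul_le_mul_of_nonneg_left (hs.evidence_le (θ := θ)) h0
  -- At most `k - 1` phases have been charged, and the unspent charge `G + 1` covers the `-G` of the
  -- current phase.
  have hp : (s.phase : ℝ) + 1 ≤ numPhases ε := by exact_mod_cast hrun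
  nlinarith [mul_le_mul_of_nonneg_left hp (by linarith : 0 ≤ G + 1)]

/-! ### The labeler at the far quartile -/

lemma pmf_toReal_add (p : PMF (Option Bool)) :
    (p none).toReal + (p (some true)).toReal + (p (some false)).toReal = 1 := by
  have h := p.tsum_coe
  rw [tsum_fintype, Fintype.sum_option, Fintype.sum_bool] at h
  rw [← ENNReal.toReal_one, ← h, ENNReal.toReal_add (p.apply_ne_top _)
    (ENNReal.add_ne_top.2 ⟨p.apply_ne_top _, p.apply_ne_top _⟩),
    ENNReal.toReal_add (p.apply_ne_top _) (p.apply_ne_top _), add_assoc]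

/-- The expected change of the potential due to a response at `x`. -/
lemma sum_factor_le {P : ℝ → PMF (Option Bool)} {θ C β c b x : ℝ} {f : ℝ → ℝ}
    (hP : BoundedNoise P θ f C β) (hx : x ∈ Set.Icc (0 : ℝ) 1) (h0 : 0 ≤ c)
    (hb0 : 0 < b) (hb : b ≤ f |x - θ|) (hc : c ≤ C * |x - θ| ^ β) :
    c ≤ 1 ∧ (P x none).toReal * factor c (trueLabel θ x) none
      + (P x (some true)).toReal * factor c (trueLabel θ x) (some true)
      + (P x (some false)).toReal * factor c (trueLabel θ x) (some false)
      ≤ exp (-(b * c ^ 2 / 16)) := by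
  have hsum := pmf_toReal_add (P x)
  have habs := hP.abstention_le x hx
  have hnoise := hP.noise_le x hx
  unfold noiseRate answerProb at hnoise
  unfold abstention at habs
  have ht : 0 ≤ (P x (some true)).toReal := ENNReal.toReal_nonneg
  have hf : 0 ≤ (P x (some false)).toReal := ENNReal.toReal_nonneg
  have hpos : 0 < (P x (some false)).toReal + (P x (some true)).toReal := by linarith
  have hw := hnoise hpos
  have hw0 : 0 ≤ (P x (some (!trueLabel θ x))).toReal := ENNReal.toReal_nonneg
  -- A noise rate cannot be negative, which bounds the assumed bias by one.
  have hc1 : c ≤ 1 := by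
    have := (div_nonneg hw0 hpos.le).trans hw
    linarith
  refine ⟨hc1, ?_⟩
  rw [div_le_iff₀ hpos] at hw
  have hw' : (P x (some (!trueLabel θ x))).toReal
      ≤ (1 - c) / 2 * ((P x (some false)).toReal + (P x (some true)).toReal) := by
    refine hw.trans (mul_le_mul_of_nonneg_right ?_ hpos.le)
    linarith
  cases hl : trueLabel θ x
  · rw [hl] at hw'
    have := mgf_le (p := (P x none).toReal) h0 hc1 (by linarith) hf ht hw'
      (b := b) (by linarith)
    simp only [factor, if_true, reduceCtorEq, if_false]
    linarith
  · rw [hl] at hw'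
    have := mgf_le (p := (P x none).toReal) h0 hc1 (by linarith) ht hf
      (by simpa [add_comm] using hw') (b := b) (by linarith)
    simp only [factor, if_true, reduceCtorEq, if_false]
    linarith

lemma Reachable.quartile_mem {D l : ℝ} {s : State} (hs : Reachable D l s) :
    s.U ∈ Set.Icc (0 : ℝ) 1 ∧ s.V ∈ Set.Icc (0 : ℝ) 1 := by
  have h := hs.length_eq
  have hp : (0 : ℝ) < (3 / 4) ^ s.phase := by positivity
  have h0 := hs.zero_le
  have h1 := hs.le_one
  unfold State.U State.V
  refine ⟨⟨?_, ?_⟩, ?_, ?_⟩ <;> linarith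

/-- A quarter of the current interval is longer than `ε / 2`. -/
lemma Reachable.half_lt {D l ε : ℝ} {s : State} (hs : Reachable D l s) {k : ℕ}
    (hε : 2 * ε = (3 / 4) ^ k) (hk : s.phase < k) : ε / 2 < (s.R - s.L) / 4 := by
  -- One more phase would still leave length at least `2ε`, so a quarter of the present length is at
  -- least `2ε / 3`.
  have h : ((3 : ℝ) / 4) ^ k ≤ (3 / 4) ^ (s.phase + 1) :=
    pow_le_pow_of_le_one (by norm_num) (by norm_num) hk
  have hp : (0 : ℝ) < (3 / 4) ^ s.phase := by positivity
  rw [hs.length_eq]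
  rw [← hε, pow_succ] at h
  linarith

/-- The total weight that the responses of a round put on the factor of the far quartile. -/
lemma sum_reply_factor (p q r : PMF (Option Bool)) (g : Option Bool → ℝ) (hg : ∀ a, 0 ≤ g a) :
    ∑ a : Option Bool, ∑ b : Option Bool, ∑ d : Option Bool,
      p a * q b * r d * ENNReal.ofReal (g a) = ENNReal.ofReal
        ((p none).toReal * g none + (p (some true)).toReal * g (some true)
          + (p (some false)).toReal * g (some false)) := by
  have h1 : ∑ b, q b = 1 := (tsum_fintype q).symm.trans q.tsum_coe
  have h2 : ∑ d, r d = 1 := (tsum_fintype r).symm.trans r.tsum_coe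
  have h3 : ∀ a, ∑ b : Option Bool, ∑ d : Option Bool,
      p a * q b * r d * ENNReal.ofReal (g a) = ENNReal.ofReal ((p a).toReal * g a) := by
    intro a
    rw [ENNReal.ofReal_mul ENNReal.toReal_nonneg, ENNReal.ofReal_toReal (p.apply_ne_top a)]
    simp_rw [mul_right_comm _ (r _), ← Finset.mul_sum, h2, mul_one, mul_right_comm _ (q _),
      ← Finset.mul_sum, h1, mul_one]
  have hn : ∀ a, 0 ≤ (p a).toReal * g a := fun a => mul_nonneg ENNReal.toReal_nonneg (hg a)
  simp_rw [h3]
  rw [Fintype.sum_option, Fintype.sum_bool, ← ENNReal.ofReal_add (hn _) (hn _),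
    ← ENNReal.ofReal_add (hn _) (add_nonneg (hn _) (hn _)), add_assoc]

lemma factor_nonneg (c : ℝ) (b : Bool) (a : Option Bool) : 0 ≤ factor c b a := by
  rcases a with _ | a
  · exact zero_le_one
  · simp only [factor]
    split_ifs <;> positivity

/-- At distance at least `ε / 2` from the boundary, a response shrinks the potential in expectation
by the factor that belongs to answers of probability `b` and labels of bias `c`. -/
def Signal (P : ℝ → PMF (Option Bool)) (θ ε c b : ℝ) : Prop :=
  ∀ x ∈ Set.Icc (0 : ℝ) 1, ε / 2 ≤ |x - θ| →
    (P x none).toReal * factor c (trueLabel θ x) none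
      + (P x (some true)).toReal * factor c (trueLabel θ x) (some true)
      + (P x (some false)).toReal * factor c (trueLabel θ x) (some false)
      ≤ exp (-(b * c ^ 2 / 16))

/-- Only the reply at the far quartile enters the bound on the potential; the other two replies
integrate to one. -/
lemma sum_potential_step_le {P : ℝ → PMF (Option Bool)} {D₀ D₁ ε δ θ c b G l : ℝ} {k : ℕ}
    (hsig : Signal P θ ε c b) (hε : 2 * ε = (3 / 4) ^ k) (hk : numPhases ε = k)
    (h0 : 0 ≤ c) (h1 : c ≤ 1)
    (hG : ∀ n : ℕ, c / 2 * threshold D₀ l n - c ^ 2 / 8 * n ≤ G)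
    {s : State} (hs : Reachable D₀ l s) (hrun : Running ε s) :
    ∑ a : Option Bool, ∑ b : Option Bool, ∑ d : Option Bool,
      P s.U a * P s.M b * P s.V d * ENNReal.ofReal (potential θ c G (step D₀ D₁ ε δ s ⟨a, b, d⟩))
      ≤ ENNReal.ofReal (exp (-(b * c ^ 2 / 16)) * potential θ c G s) := by
  have hε0 : 0 < ε := by
    have : (0 : ℝ) < (3 / 4) ^ k := by positivity
    linarith
  have hpot : 0 ≤ potential θ c G s := (exp_pos _).le
  have hlt := hs.half_lt hε (by rw [← hk]; exact hrun)
  obtain ⟨hU, hV⟩ := hs.quartile_mem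
  have hle := fun r => ENNReal.ofReal_le_ofReal
    (potential_step_le (D₁ := D₁) (δ := δ) (θ := θ) h0 h1 hG hs hrun r)
  by_cases hθ : θ ≤ s.M
  · have hd : s.V - θ ≥ (s.R - s.L) / 4 := by
      unfold State.M at hθ
      unfold State.V
      linarith
    have hlab : trueLabel θ s.V = true := by
      simp only [trueLabel, decide_eq_true_eq]
      linarith
    have hx := hsig s.V hV (by rw [abs_of_nonneg] <;> linarith)
    rw [hlab] at hx
    simp only [if_pos hθ] at hle
    calc _ ≤ ∑ a : Option Bool, ∑ b : Option Bool, ∑ d : Option Bool,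
          ENNReal.ofReal (potential θ c G s) *
            (P s.V d * P s.M b * P s.U a * ENNReal.ofReal (factor c true d)) := by
          refine Finset.sum_le_sum fun a _ => Finset.sum_le_sum fun b _ =>
            Finset.sum_le_sum fun d _ => ?_
          calc _ ≤ P s.U a * P s.M b * P s.V d *
                ENNReal.ofReal (potential θ c G s * factor c true d) :=
                mul_le_mul' le_rfl (hle ⟨a, b, d⟩)
            _ = _ := by
                rw [ENNReal.ofReal_mul hpot]
                ring
      _ = ENNReal.ofReal (potential θ c G s) * ∑ d : Option Bool, ∑ b : Option Bool,
            ∑ a : Option Bool,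
              P s.V d * P s.M b * P s.U a * ENNReal.ofReal (factor c true d) := by
          simp_rw [← Finset.mul_sum]
          -- The far quartile is now `V`, so its sum is moved outermost to match `sum_reply_factor`.
          congr 1
          calc _ = ∑ a : Option Bool, ∑ d : Option Bool, ∑ b : Option Bool, _ :=
                Finset.sum_congr rfl fun a _ => Finset.sum_comm
            _ = ∑ d : Option Bool, ∑ a : Option Bool, ∑ b : Option Bool, _ := Finset.sum_comm
            _ = _ := Finset.sum_congr rfl fun d _ => Finset.sum_comm
      _ ≤ _ := by
          rw [sum_reply_factor _ _ _ _ (factor_nonneg c true), ← ENNReal.ofReal_mul hpot]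
          exact ENNReal.ofReal_le_ofReal (by nlinarith)
  · have hd : θ - s.U ≥ (s.R - s.L) / 4 := by
      unfold State.M at hθ
      unfold State.U
      linarith
    have hlab : trueLabel θ s.U = false := by
      simp only [trueLabel, decide_eq_false_iff_not]
      linarith
    have hx := hsig s.U hU (by rw [abs_sub_comm, abs_of_nonneg] <;> linarith)
    rw [hlab] at hx
    simp only [if_neg hθ] at hle
    calc _ ≤ ∑ a : Option Bool, ∑ b : Option Bool, ∑ d : Option Bool,
          ENNReal.ofReal (potential θ c G s) *
            (P s.U a * P s.M b * P s.V d * ENNReal.ofReal (factor c false a)) := by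
          refine Finset.sum_le_sum fun a _ => Finset.sum_le_sum fun b _ =>
            Finset.sum_le_sum fun d _ => ?_
          calc _ ≤ P s.U a * P s.M b * P s.V d *
                ENNReal.ofReal (potential θ c G s * factor c false a) :=
                mul_le_mul' le_rfl (hle ⟨a, b, d⟩)
            _ = _ := by
                rw [ENNReal.ofReal_mul hpot]
                ring
      _ ≤ _ := by
          simp_rw [← Finset.mul_sum]
          rw [sum_reply_factor _ _ _ _ (factor_nonneg c false), ← ENNReal.ofReal_mul hpot]
          exact ENNReal.ofReal_le_ofReal (by nlinarith)

/-! ### The running time -/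

lemma stateAt_congr {D₀ D₁ ε δ : ℝ} {y z : ℕ → Reply} {t : ℕ} (h : ∀ i < t, y i = z i) :
    stateAt D₀ D₁ ε δ y t = stateAt D₀ D₁ ε δ z t := by
  induction t with
  | zero => rfl
  | succ t ih =>
    rw [stateAt, stateAt, ih fun i hi => h i (by omega), h t (by omega)]

lemma stateAt_add_of_not_running {D₀ D₁ ε δ : ℝ} {y : ℕ → Reply} {t : ℕ}
    (h : ¬ Running ε (stateAt D₀ D₁ ε δ y t)) (k : ℕ) :
    stateAt D₀ D₁ ε δ y (t + k) = stateAt D₀ D₁ ε δ y t := by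
  induction k with
  | zero => rfl
  | succ k ih => rw [← add_assoc, stateAt, ih, step, if_neg h]

lemma queries_step_le (D₀ D₁ ε δ : ℝ) (s : State) (r : Reply) :
    (step D₀ D₁ ε δ s r).queries ≤ s.queries + 3 := by
  unfold step
  split_ifs
  · rcases test_cases D₀ D₁ ε δ (record s r) with h | h | ⟨h, -, -⟩ <;> rw [h] <;> rfl
  · omega

lemma queries_stateAt_le (D₀ D₁ ε δ : ℝ) (y : ℕ → Reply) (t : ℕ) :
    (stateAt D₀ D₁ ε δ y t).queries ≤ 3 * t := by
  induction t with
  | zero => rfl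
  | succ t ih =>
    have := queries_step_le D₀ D₁ ε δ (stateAt D₀ D₁ ε δ y t) (y t)
    rw [stateAt]
    omega

lemma numQueries_le_of_not_running {D₀ D₁ ε δ : ℝ} {y : ℕ → Reply} {t : ℕ}
    (h : ¬ Running ε (stateAt D₀ D₁ ε δ y t)) :
    numQueries D₀ D₁ ε δ y ≤ ((3 * t : ℕ) : ℕ∞) := by
  refine iSup_le fun i => ?_
  rw [Nat.cast_le]
  rcases le_total i t with hi | hi
  · exact (queries_stateAt_le D₀ D₁ ε δ y i).trans (by omega)
  · obtain ⟨k, rfl⟩ := Nat.exists_eq_add_of_le hi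
    rw [stateAt_add_of_not_running h]
    exact queries_stateAt_le D₀ D₁ ε δ y t

open MeasureTheory in
/-- Given the first `t` rounds, the probability of running for `k` further rounds decays
exponentially in `k`, from the current value of the potential on. -/
lemma measure_running_le {P : ℝ → PMF (Option Bool)} {D₀ D₁ ε δ θ c b G : ℝ} {k : ℕ}
    (hsig : Signal P θ ε c b) (hε : 2 * ε = (3 / 4) ^ k) (hk : numPhases ε = k)
    (h0 : 0 ≤ c) (h1 : c ≤ 1) (hD : 0 < D₀) (hl : 0 ≤ log (1 / testLevel ε δ)) (hG0 : 0 ≤ G)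
    (hG : ∀ n : ℕ, c / 2 * threshold D₀ (log (1 / testLevel ε δ)) n - c ^ 2 / 8 * n ≤ G)
    {Ω : Type*} [MeasurableSpace Ω] {μ : Measure Ω} {Y : ℕ → Ω → Reply}
    (hY : IsInteraction D₀ D₁ ε δ P μ Y) (j : ℕ) : ∀ (t : ℕ) (h : ℕ → Reply),
    μ {ω | (∀ i < t, Y i ω = h i) ∧ Running ε (stateAt D₀ D₁ ε δ (fun i => Y i ω) (t + j))} ≤
      μ {ω | ∀ i < t, Y i ω = h i} *
        ENNReal.ofReal (exp ((G + 1) * k - b * c ^ 2 / 16 * j) *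
          potential θ c G (stateAt D₀ D₁ ε δ h t)) := by
  -- The remaining number of rounds is the induction variable, with the history generalised:
  -- conditioning on the next reply extends the cylinder by one round.
  induction j with
  | zero =>
    intro t h
    by_cases hrun : Running ε (stateAt D₀ D₁ ε δ h t)
    · have h1 := one_le_potential (θ := θ) h0 hG hG0
        (reachable_stateAt (D₁ := D₁) hD hl h t) hrun
      rw [hk] at h1
      calc _ ≤ μ {ω | ∀ i < t, Y i ω = h i} * 1 := by
            rw [mul_one]
            exact measure_mono fun ω hω => hω.1
        _ ≤ _ := by
            gcongr
            simpa using h1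
    -- A stopped history makes the event empty, so `law`, which holds only while running, is not
    -- needed.
    · refine (measure_mono_null ?_ measure_empty).le.trans zero_le
      rintro ω ⟨h2, h3⟩
      rw [add_zero, stateAt_congr h2] at h3
      exact hrun h3
  | succ j ih =>
    intro t h
    set s := stateAt D₀ D₁ ε δ h t with hs
    by_cases hrun : Running ε s
    · have hstep : ∀ r : Reply,
          stateAt D₀ D₁ ε δ (Function.update h t r) (t + 1) = step D₀ D₁ ε δ s r := by
        intro r
        rw [stateAt, Function.update_self, hs]
        congr 1
        exact stateAt_congr fun i hi => Function.update_of_ne (by omega) _ _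
      have hcyl : ∀ r : Reply, {ω | ∀ i < t + 1, Y i ω = Function.update h t r i} =
          {ω | (∀ i < t, Y i ω = h i) ∧ Y t ω = r} := by
        intro r
        ext ω
        simp only [Set.mem_ofPred_eq, Nat.forall_lt_succ_right, Function.update_self]
        refine and_congr_left' (forall₂_congr fun i hi => ?_)
        rw [Function.update_of_ne (by omega)]
      calc _ ≤ μ (⋃ a : Option Bool, ⋃ b : Option Bool, ⋃ d : Option Bool,
              {ω | (∀ i < t + 1, Y i ω = Function.update h t ⟨a, b, d⟩ i) ∧
                Running ε (stateAt D₀ D₁ ε δ (fun i => Y i ω) (t + 1 + j))}) := by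
            refine measure_mono ?_
            rintro ω ⟨h2, h3⟩
            simp only [Set.mem_iUnion]
            refine ⟨(Y t ω).u, (Y t ω).m, (Y t ω).v, ?_, by rwa [add_assoc, add_comm 1]⟩
            have : ω ∈ {ω | ∀ i < t + 1, Y i ω = Function.update h t (Y t ω) i} := by
              rw [Set.mem_ofPred_eq]
              intro i hi
              rcases Nat.lt_succ_iff_lt_or_eq.1 hi with hi | rfl
              · rw [Function.update_of_ne (by omega), h2 i hi]
              · rw [Function.update_self]
            exact this
        _ ≤ ∑ a : Option Bool, ∑ b : Option Bool, ∑ d : Option Bool,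
              μ {ω | (∀ i < t + 1, Y i ω = Function.update h t ⟨a, b, d⟩ i) ∧
                Running ε (stateAt D₀ D₁ ε δ (fun i => Y i ω) (t + 1 + j))} := by
            refine (measure_iUnion_fintype_le _ _).trans (Finset.sum_le_sum fun a _ => ?_)
            refine (measure_iUnion_fintype_le _ _).trans (Finset.sum_le_sum fun b _ => ?_)
            exact measure_iUnion_fintype_le _ _
        _ ≤ ∑ a : Option Bool, ∑ b' : Option Bool, ∑ d : Option Bool,
              μ {ω | ∀ i < t, Y i ω = h i} *
                ENNReal.ofReal (exp ((G + 1) * k - b * c ^ 2 / 16 * j)) *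
                (P s.U a * P s.M b' * P s.V d *
                  ENNReal.ofReal (potential θ c G (step D₀ D₁ ε δ s ⟨a, b', d⟩))) := by
            refine Finset.sum_le_sum fun a _ => Finset.sum_le_sum fun b' _ =>
              Finset.sum_le_sum fun d _ => ?_
            refine (ih _ _).trans ?_
            rw [hcyl, hY.law t h _ hrun, hstep, ENNReal.ofReal_mul (exp_pos _).le]
            exact le_of_eq (by ring)
        _ ≤ μ {ω | ∀ i < t, Y i ω = h i} *
                ENNReal.ofReal (exp ((G + 1) * k - b * c ^ 2 / 16 * j)) *
              ENNReal.ofReal (exp (-(b * c ^ 2 / 16)) * potential θ c G s) := by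
            simp_rw [← Finset.mul_sum]
            gcongr
            exact sum_potential_step_le hsig hε hk h0 h1 hG
              (reachable_stateAt hD hl h t) hrun
        _ = _ := by
            rw [mul_assoc, ← ENNReal.ofReal_mul (exp_pos _).le, ← mul_assoc (exp _) (exp _),
              ← exp_add]
            congr 4
            push_cast
            ring
    · refine (measure_mono_null ?_ measure_empty).le.trans zero_le
      rintro ω ⟨h2, h3⟩
      rw [stateAt_add_of_not_running (by rwa [stateAt_congr h2]), stateAt_congr h2] at h3
      exact hrun h3

open MeasureTheory in
lemma measure_not_numQueries_le {P : ℝ → PMF (Option Bool)} {D₀ D₁ ε δ θ c b G : ℝ} {k : ℕ}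
    (hsig : Signal P θ ε c b) (hε : 2 * ε = (3 / 4) ^ k) (hk : numPhases ε = k)
    (h0 : 0 < c) (h1 : c ≤ 1) (hb : 0 < b) (hδ : 0 < δ)
    (hD : 0 < D₀) (hl : 0 ≤ log (1 / testLevel ε δ)) (hG0 : 0 ≤ G)
    (hG : ∀ n : ℕ, c / 2 * threshold D₀ (log (1 / testLevel ε δ)) n - c ^ 2 / 8 * n ≤ G)
    {Ω : Type*} [MeasurableSpace Ω] {μ : Measure Ω} [IsProbabilityMeasure μ] {Y : ℕ → Ω → Reply}
    (hY : IsInteraction D₀ D₁ ε δ P μ Y) {t : ℕ}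
    (ht : ((G + 1) * k + log (1 / δ)) / (b * c ^ 2 / 16) ≤ t) :
    μ {ω | Running ε (stateAt D₀ D₁ ε δ (fun i => Y i ω) t)} ≤ ENNReal.ofReal δ := by
  -- The empty history has full measure and initial potential `1`.
  have h := measure_running_le hsig hε hk h0.le h1 hD hl hG0 hG hY t 0 fun _ => ⟨none, none, none⟩
  simp only [Nat.not_lt_zero, IsEmpty.forall_iff, implies_true, true_and, zero_add,
    Set.ofPred_true, measure_univ, one_mul] at h
  refine h.trans (ENNReal.ofReal_le_ofReal ?_)
  rw [stateAt, potential_start, ← exp_add, ← le_log_iff_exp_le hδ]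
  rw [div_le_iff₀ (by positivity), one_div, log_inv] at ht
  push_cast
  linarith

/-! ### Constants -/

/-- The bound on the potential of a running phase. -/
noncomputable def phaseCost (D l B : ℝ) : ℝ := D * (1 + l) + 4 * D ^ 2 * (log B + l) + exp (exp 1)

/-- The factor by which `log (1 / ε)` (or `e`) is multiplied in `threshold_le`. -/
noncomputable def logConst (D C β : ℝ) : ℝ := 1 + |log (256 * D ^ 2)| + 2 * |log C| + 4 * β

lemma one_le_logConst {D C β : ℝ} (hβ : 0 ≤ β) : 1 ≤ logConst D C β := by
  unfold logConst
  have := abs_nonneg (log (256 * D ^ 2))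
  have := abs_nonneg (log C)
  linarith

lemma neg_log_le_logConst_mul {D C β ε X : ℝ} (hD : 0 < D) (hC : 0 < C) (hβ : 0 ≤ β) (hε : 0 < ε)
    (hX : 1 ≤ X) (hεX : log (1 / ε) ≤ X) :
    -log ((C * (ε / 2) ^ β) ^ 2 / (256 * D ^ 2)) ≤ logConst D C β * X := by
  have h1 : log ((C * (ε / 2) ^ β) ^ 2 / (256 * D ^ 2))
      = 2 * (log C + β * (log ε - log 2)) - log (256 * D ^ 2) := by
    rw [log_div (by positivity) (by positivity), log_pow, log_mul hC.ne' (by positivity),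
      log_rpow (by positivity), log_div hε.ne' two_ne_zero]
    norm_num
  rw [one_div, log_inv] at hεX
  have h2 : log 2 ≤ 1 := by linarith [log_two_lt_d9]
  have h3 : β * (-log ε + log 2) ≤ β * (2 * X) := mul_le_mul_of_nonneg_left (by linarith) hβ
  have h4 := le_abs_self (log (256 * D ^ 2))
  have h5 := neg_abs_le (log C)
  have h6 := mul_le_mul_of_nonneg_left hX (abs_nonneg (log (256 * D ^ 2)))
  have h7 := mul_le_mul_of_nonneg_left hX (abs_nonneg (log C))
  rw [h1, logConst]
  nlinarith

/-- The factor in front of `log (1 / δ) + logLogPlus (1 / ε)` in the cost of a phase. -/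
noncomputable def costConst (D C β : ℝ) : ℝ :=
  5 * D + 4 * D ^ 2 * (logConst D C β + 5) + exp (exp 1) + 1

lemma phaseCost_add_one_le {D l C β X d Λ : ℝ} (hD : 0 < D) (hβ : 0 ≤ β) (hX : 0 < X)
    (hΛ : log X = Λ) (hΛ1 : 1 ≤ Λ) (hd : 0 ≤ d) (hl : l ≤ 4 * Λ + d) :
    phaseCost D l (logConst D C β * X) + 1 ≤ costConst D C β * (d + Λ) := by
  have hK := one_le_logConst (D := D) (C := C) hβ
  set K := logConst D C β with hKdef
  have h1 : log (K * X) ≤ K + Λ := by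
    rw [log_mul (by linarith) hX.ne', hΛ]
    linarith [log_le_sub_one_of_pos (show 0 < K by linarith)]
  have h2 : log (K * X) + l ≤ (K + 5) * (d + Λ) := by nlinarith
  have h3 := mul_le_mul_of_nonneg_left h2 (by positivity : 0 ≤ 4 * D ^ 2)
  have h4 : D * (1 + l) ≤ D * (5 * (d + Λ)) := mul_le_mul_of_nonneg_left (by linarith) hD.le
  have h5 : exp (exp 1) * 1 ≤ exp (exp 1) * (d + Λ) :=
    mul_le_mul_of_nonneg_left (by linarith) (exp_pos _).le
  rw [phaseCost, costConst, ← hKdef]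
  nlinarith

/-- The constant of the main theorem. -/
noncomputable def queryConst (D C β : ℝ) : ℝ :=
  3 * (4 * costConst D C β + 4) * (16 * 2 ^ (2 * β) / C ^ 2)

lemma costConst_pos {D C β : ℝ} (hD : 0 < D) (hβ : 0 ≤ β) : 0 < costConst D C β := by
  have := one_le_logConst (D := D) (C := C) hβ
  unfold costConst
  positivity

lemma queryConst_pos {D C β : ℝ} (hD : 0 < D) (hC : 0 < C) (hβ : 0 ≤ β) :
    0 < queryConst D C β := by
  have := costConst_pos (C := C) hD hβ
  unfold queryConst
  positivity

lemma three_mul_ceil_le {D C β ε b d Λ k G : ℝ} (hD : 0 < D) (hC : 0 < C) (hβ : 0 ≤ β)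
    (hε : 0 < ε) (hε1 : ε ≤ 1 / 2) (hb0 : 0 < b) (hb1 : b ≤ 1) (hc1 : C * (ε / 2) ^ β ≤ 1)
    (hd : 0 ≤ d) (hΛ : 1 ≤ Λ) (hk0 : 0 ≤ k) (hk : k ≤ 4 * log (1 / ε)) (hG0 : 0 ≤ G)
    (hG : G + 1 ≤ costConst D C β * (d + Λ)) :
    3 * (⌈((G + 1) * k + d) / (b * (C * (ε / 2) ^ β) ^ 2 / 16)⌉₊ : ℝ) ≤
      queryConst D C β * (ε ^ (-2 * β) / b * (log (1 / ε) * (d + Λ) * Λ)) := by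
  set c := C * (ε / 2) ^ β with hc
  have hc0 : 0 < c := by positivity
  set σ := b * c ^ 2 / 16 with hσ
  have hσ0 : 0 < σ := by positivity
  have hσ1 : σ ≤ 1 := by
    have : c ^ 2 ≤ 1 := by nlinarith
    nlinarith
  have hK := costConst_pos (C := C) hD hβ
  set A := log (1 / ε) * (d + Λ) with hA
  have hlog : 1 / 2 ≤ log (1 / ε) := by
    have h2 : (2 : ℝ) ≤ 1 / ε := by
      rw [le_div_iff₀ hε]
      linarith
    linarith [log_le_log (by norm_num) h2, log_two_gt_d9]
  -- Since `log (1 / ε) ≥ 1/2`, this absorbs the lone `d` here and, as `σ ≤ 1 ≤ 2 * A`, the rounding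
  -- up in `h2`.
  have hA1 : d + Λ ≤ 2 * A := by nlinarith
  have h1 : (G + 1) * k + d ≤ (4 * costConst D C β + 2) * A := by
    have := mul_le_mul hG hk hk0 (by positivity)
    nlinarith
  have hceil := Nat.ceil_lt_add_one (show 0 ≤ ((G + 1) * k + d) / σ by positivity)
  have h2 : ((G + 1) * k + d) / σ + 1 ≤ (4 * costConst D C β + 4) * A / σ := by
    rw [le_div_iff₀ hσ0, add_mul, div_mul_cancel₀ _ hσ0.ne']
    linarith
  have h3 : 1 / σ = 16 * 2 ^ (2 * β) / C ^ 2 * (ε ^ (-2 * β) / b) := by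
    rw [hσ, hc, mul_pow, ← rpow_natCast ((ε / 2) ^ β), ← rpow_mul (by positivity),
      show β * ((2 : ℕ) : ℝ) = 2 * β by push_cast; ring, div_rpow hε.le (by norm_num),
      neg_mul, rpow_neg hε.le]
    field_simp
  have h4 : 3 * ((4 * costConst D C β + 4) * A / σ)
      = queryConst D C β * (ε ^ (-2 * β) / b * A) := by
    rw [div_eq_mul_one_div, h3, queryConst]
    ring
  -- The estimate holds without the last factor `Λ ≥ 1`, which is inserted to match the stated
  -- bound.
  have h5 : queryConst D C β * (ε ^ (-2 * β) / b * A)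
      ≤ queryConst D C β * (ε ^ (-2 * β) / b * (A * Λ)) := by
    have := queryConst_pos hD hC hβ
    have hA0 : 0 ≤ A := by linarith
    gcongr
    exact le_mul_of_one_le_right hA0 hΛ
  linarith

/-! ### From the noise conditions to the main theorem -/

lemma two_mul_eq_pow {ε : ℝ} (hε : 0 < ε) {k : ℕ} (hk : logb (4 / 3) (1 / (2 * ε)) = k) :
    2 * ε = (3 / 4) ^ k := by
  rw [logb_eq_iff_rpow_eq (by norm_num) (by norm_num) (by positivity), rpow_natCast] at hk
  rw [← inv_inj, ← one_div, ← hk, ← inv_pow]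
  norm_num

lemma signal_of_boundedNoise {P : ℝ → PMF (Option Bool)} {θ C β ε : ℝ} {f : ℝ → ℝ}
    (hP : BoundedNoise P θ f C β) (hf : MonotoneOn f (Set.Icc 0 1)) (hθ : θ ∈ Set.Icc (0 : ℝ) 1)
    (hC : 0 < C) (hβ : 0 ≤ β) (hε : 0 < ε) (hε1 : ε ≤ 1 / 2) (hfε : 0 < f (ε / 2)) :
    C * (ε / 2) ^ β ≤ 1 ∧ Signal P θ ε (C * (ε / 2) ^ β) (f (ε / 2)) := by
  have key : ∀ x ∈ Set.Icc (0 : ℝ) 1, ε / 2 ≤ |x - θ| → _ := fun x hx hd =>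
    sum_factor_le hP hx (c := C * (ε / 2) ^ β) (by positivity) hfε
      (hf ⟨by linarith, by linarith⟩
        ⟨abs_nonneg _, abs_le.2 ⟨by linarith [hx.1, hθ.2], by linarith [hx.2, hθ.1]⟩⟩ hd)
      (by gcongr)
  refine ⟨?_, fun x hx hd => (key x hx hd).2⟩
  -- One endpoint of `[0, 1]` is at distance at least `1/2 ≥ ε / 2` from `θ`; its noise rate forces
  -- `c ≤ 1`.
  rcases le_total θ (1 / 2) with h | h
  · exact (key 1 ⟨by norm_num, le_rfl⟩ (by rw [abs_of_nonneg] <;> linarith)).1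
  · exact (key 0 ⟨le_rfl, by norm_num⟩ (by rw [abs_sub_comm, abs_of_nonneg] <;> linarith)).1

open MeasureTheory in
lemma ofReal_one_sub_le_measure {Ω : Type*} [MeasurableSpace Ω] {μ : Measure Ω}
    [IsProbabilityMeasure μ] {δ : ℝ} (hδ : 0 ≤ δ) {s t : Set Ω} (hs : μ s ≤ ENNReal.ofReal δ)
    (ht : ∀ ω, ω ∉ s → ω ∈ t) : ENNReal.ofReal (1 - δ) ≤ μ t := by
  rw [ENNReal.ofReal_sub _ hδ, ENNReal.ofReal_one, tsub_le_iff_right, ← measure_univ (μ := μ)]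
  calc μ Set.univ ≤ μ (t ∪ s) := measure_mono fun ω _ => by
        by_cases h : ω ∈ s
        · exact Or.inr h
        · exact Or.inl (ht ω h)
    _ ≤ μ t + μ s := measure_union_le _ _
    _ ≤ _ := by gcongr

lemma numQueries_le_ofReal {D₀ D₁ ε δ x : ℝ} {y : ℕ → Reply} {t : ℕ}
    (h : ¬ Running ε (stateAt D₀ D₁ ε δ y t)) (hx : 3 * (t : ℝ) ≤ x) :
    ((numQueries D₀ D₁ ε δ y : ℕ∞) : ENNReal) ≤ ENNReal.ofReal x := by
  calc ((numQueries D₀ D₁ ε δ y : ℕ∞) : ENNReal) ≤ (((3 * t : ℕ) : ℕ∞) : ENNReal) :=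
        ENat.toENNReal_le.2 (numQueries_le_of_not_running h)
    _ = ENNReal.ofReal ((3 * t : ℕ) : ℝ) := by rw [ENat.toENNReal_coe, ENNReal.ofReal_natCast]
    _ ≤ _ := ENNReal.ofReal_le_ofReal (by push_cast; exact hx)

end AbstainingLabeler

open AbstainingLabeler in

theorem mainTheorem3 (D₀ D₁ : ℝ) (hD₀ : 0 < D₀) (hD₁ : 0 < D₁)
    (C β : ℝ) (hC : 0 < C) (hβ : 0 ≤ β) :
    ∃ K : ℝ, 0 < K ∧
      ∀ (f : ℝ → ℝ), MonotoneOn f (Set.Icc 0 1) →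
        Set.MapsTo f (Set.Icc 0 1) (Set.Icc 0 1) →
      ∀ (θ : ℝ), θ ∈ Set.Icc (0 : ℝ) 1 →
      ∀ (P : ℝ → PMF (Option Bool)),
        AbstainingLabeler.MonotoneAbstention P θ →
        AbstainingLabeler.BoundedNoise P θ f C β →
      ∀ (ε δ : ℝ), 0 < ε → (∃ k : ℕ, Real.logb (4 / 3) (1 / (2 * ε)) = k) →
        0 < δ → δ < 1 → 0 < f (ε / 2) →
      ∀ {Ω : Type*} [MeasurableSpace Ω] (μ : MeasureTheory.Measure Ω)
        [MeasureTheory.IsProbabilityMeasure μ] (Y : ℕ → Ω → AbstainingLabeler.Reply),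
        AbstainingLabeler.IsInteraction D₀ D₁ ε δ P μ Y →
        ENNReal.ofReal (1 - δ) ≤
          μ {ω | ((AbstainingLabeler.numQueries D₀ D₁ ε δ (fun t => Y t ω) : ℕ∞) : ENNReal) ≤
            ENNReal.ofReal (K * (ε ^ (-2 * β) / f (ε / 2) *
              (Real.log (1 / ε) *
                (Real.log (1 / δ) + AbstainingLabeler.logLogPlus (1 / ε)) *
                AbstainingLabeler.logLogPlus (1 / ε))))} := by
  refine ⟨queryConst D₀ C β, queryConst_pos hD₀ hC hβ, ?_⟩
  intro f hf hfm θ hθ P _ hP ε δ hε ⟨k, hk⟩ hδ hδ1 hfε Ω _ μ _ Y hY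
  have hpow := two_mul_eq_pow hε hk
  have hnum : numPhases ε = k := by rw [numPhases, hk, Nat.floor_natCast]
  have hε1 : ε ≤ 1 / 2 := by
    have : ((3 : ℝ) / 4) ^ k ≤ 1 := pow_le_one₀ (by norm_num) (by norm_num)
    linarith
  have hfε1 : f (ε / 2) ≤ 1 := (hfm ⟨by linarith, by linarith⟩).2
  have hΛ := one_le_logLogPlus (1 / ε)
  have hd : 0 ≤ Real.log (1 / δ) := Real.log_nonneg (by rw [le_div_iff₀ hδ]; linarith)
  have hlogε : 0 ≤ Real.log (1 / ε) := Real.log_nonneg (by rw [le_div_iff₀ hε]; linarith)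
  -- For `ε = 1/2` there are no phases and no queries, and the test level is a division by zero.
  rcases Nat.eq_zero_or_pos k with rfl | hk1
  · refine ofReal_one_sub_le_measure hδ.le (s := ∅) (by simp) fun ω _ => ?_
    refine numQueries_le_ofReal (t := 0) (by simp [Running, hnum]) ?_
    have := queryConst_pos hD₀ hC hβ
    have : 0 ≤ ε ^ (-2 * β) := Real.rpow_nonneg hε.le _
    simp only [Nat.cast_zero, mul_zero]
    positivity
  have hk0 : (0 : ℝ) < k := by exact_mod_cast hk1
  set X := Real.log (max (1 / ε) (Real.exp (Real.exp 1))) with hX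
  have hm : 0 < max (1 / ε) (Real.exp (Real.exp 1)) := lt_max_of_lt_right (Real.exp_pos _)
  have hX1 : 1 ≤ X :=
    (Real.one_le_exp zero_le_one).trans ((Real.le_log_iff_exp_le hm).2 (le_max_right _ _))
  have hεX : Real.log (1 / ε) ≤ X := Real.log_le_log (by positivity) (le_max_left _ _)
  have hΛX : Real.log X = logLogPlus (1 / ε) := rfl
  have hk4 : (k : ℝ) ≤ 4 * Real.log (1 / ε) := by
    have h43 : (1 : ℝ) / 4 ≤ Real.log (4 / 3) := by
      have := Real.one_sub_inv_le_log_of_pos (show (0 : ℝ) < 4 / 3 by norm_num)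
      norm_num at this ⊢
      linarith
    have h1 : (k : ℝ) * Real.log (4 / 3) = Real.log (1 / (2 * ε)) := by
      rw [← hk, Real.logb, div_mul_cancel₀ _ (by linarith)]
    have h2 : Real.log (1 / (2 * ε)) ≤ Real.log (1 / ε) := by
      apply Real.log_le_log (by positivity)
      gcongr
      linarith
    nlinarith
  have hlevel : Real.log (1 / testLevel ε δ) = Real.log (4 * k) + Real.log (1 / δ) := by
    rw [testLevel, hk, ← Real.log_mul (by positivity) (by positivity)]
    congr 1
    field_simp
  have hl0 : 0 ≤ Real.log (4 * k) := by
    apply Real.log_nonneg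
    have : (1 : ℝ) ≤ k := by exact_mod_cast hk1
    linarith
  -- The number of phases enters the level only through its logarithm, which is of order `log log (1
  -- / ε)`; here `4 log 2 ≤ 3`.
  have hl4 : Real.log (4 * k) ≤ 4 * logLogPlus (1 / ε) := by
    have h16 : Real.log (16 * X) = 4 * Real.log 2 + logLogPlus (1 / ε) := by
      rw [Real.log_mul (by norm_num) (by linarith), hΛX, show (16 : ℝ) = 2 ^ 4 by norm_num,
        Real.log_pow]
      norm_num
    have := Real.log_le_log (by positivity) (show 4 * (k : ℝ) ≤ 16 * X by linarith)
    linarith [Real.log_two_lt_d9]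
  obtain ⟨hc1, hsig⟩ := signal_of_boundedNoise hP hf hθ hC hβ hε hε1 hfε
  have hl : 0 ≤ Real.log (1 / testLevel ε δ) := by linarith
  have hB : 1 ≤ logConst D₀ C β * X := one_le_mul_of_one_le_of_one_le (one_le_logConst hβ) hX1
  have hc0 : 0 < C * (ε / 2) ^ β := mul_pos hC (Real.rpow_pos_of_pos (by linarith) _)
  have hG := threshold_le hD₀ hl hc0 hc1 hB (neg_log_le_logConst_mul hD₀ hC hβ hε hX1 hεX)
  have hG0 : 0 ≤ phaseCost D₀ (Real.log (1 / testLevel ε δ)) (logConst D₀ C β * X) := by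
    have := Real.log_nonneg hB
    unfold phaseCost
    positivity
  have hcost := phaseCost_add_one_le (C := C) (l := Real.log (1 / testLevel ε δ)) hD₀ hβ
    (by linarith) hΛX hΛ hd (by linarith)
  refine ofReal_one_sub_le_measure hδ.le
    (measure_not_numQueries_le hsig hpow hnum hc0 hc1 hfε hδ hD₀ hl hG0 hG hY (Nat.le_ceil _))
    fun ω hω => numQueries_le_ofReal hω ?_
  exact three_mul_ceil_le hD₀ hC hβ hε hε1 hfε hfε1 hc1 hd hΛ hk0.le hk4 hG0 hcost
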